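/- Let $\psi\in C^1(\mathbb R^2,\mathbb R^2)$ and $\phi\in C(\mathbb R\times\mathbb R^2\times[0,1],\mathbb R^2)$, with $\phi$ $T$-periodic in its first variable. Let $x_0$ be a limit cycle of $\dot x=\psi(x)$ with smallest period $T>0$, and suppose that the linearized system $\dot y=\psi'(x_0(t))y$ has only one characteristic multiplier equal to $1$ (that is, $1$ is a simple multiplier). Let $z_0$ and $z_1$ be nontrivial solutions of the adjoint system $\dot z=-(\psi'(x_0(t)))^*z$ with $z_0(t+T)=z_0(t)$ and $z_1(t+T)=\rho_*z_1(t)$, where $\rho_*\neq1$. Put $$f_1(\theta,s)=\int_{s-T}^{s}\langle z_1(\tau),\phi(\tau-\theta,x_0(\tau),0)\rangle\,d\tau .$$ Let $a^\perp$ be the vector $a\in\mathbb R^2$ rotated clockwise by $\pi/2$, and let $$I(t,r)=\Omega\Big(T,0,\;x_0(t)+r\,\tfrac{z_0(t)^\perp}{\|z_0(t)^\perp\|}\Big),$$ where $\Omega(\cdot,0,\xi)$ is the solution of $\dot x=\psi(x)$ with $x(0)=\xi$. Let $\theta_0\in[0,T]$ and suppose that for all sufficiently small $\varepsilon>0$ the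 system $\dot x=\psi(x)+\varepsilon\phi(t,x,\varepsilon)$ has a $T$-periodic solution $x_\varepsilon$ such that $x_\varepsilon(t-\theta_0)\to x_0(t)$ as $\varepsilon\to0$ for every $t\in[0,T]$. Then there are $r_0\in(0,1]$ and $\varepsilon_0>0$ such that $I(t,r)$ is defined for all $t\in[0,T]$, $r\in[-r_0,r_0]$, and the following holds. There are numbers $\theta_\varepsilon(t)$ such that $\theta_\varepsilon(t)\to\theta_0$ as $\varepsilon\to0$ uniformly in $t\in[0,T]$ and $x_\varepsilon(t-\theta_\varepsilon(t))\in I(t,[-r_0,r_0])$ for all $\varepsilon\in(0,\varepsilon_0)$, $t\in[0,T]$. For any such $\theta_\varepsilon(t)$, $$\|x_\varepsilon(t-\theta_\varepsilon(t))-x_0(t)\|=o(\varepsilon)\quad\text{as }\varepsilon\to0$$ for every $t\in[0,T]$ with $f_1(\theta_0,t)=0$, uniformly with respect to all such $t$. -/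

import Mathlib

open Set Filter Topology

namespace LimitCycle

/-- The Euclidean plane. -/
abbrev Plane : Type := EuclideanSpace ℝ (Fin 2)

/-- `x` is a solution on the whole line of the system `x' = ψ(x)`. -/
def IsSolution (ψ : Plane → Plane) (x : ℝ → Plane) : Prop :=
  ∀ t, HasDerivAt x (ψ (x t)) t

/-- `x` is a solution on the whole line of the system `x' = ψ(x) + ε φ(t, x, ε)`. -/
def IsPerturbedSolution (ψ : Plane → Plane) (φ : ℝ → Plane → ℝ → Plane) (ε : ℝ)
    (x : ℝ → Plane) : Prop :=
  ∀ t, HasDerivAt x (ψ (x t) + ε • φ t (x t) ε) t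

/-- `x₀` is a limit cycle of `x' = ψ(x)` with smallest period `T > 0`: a periodic solution with
smallest period `T` whose orbit is isolated among the orbits of nonconstant periodic solutions.
(A constant `x₀` is excluded, since it has arbitrarily small periods.) -/
structure IsLimitCycle (ψ : Plane → Plane) (x₀ : ℝ → Plane) (T : ℝ) : Prop where
  solution : IsSolution ψ x₀
  period_pos : 0 < T
  periodic : Function.Periodic x₀ T
  smallest : ∀ S, 0 < S → Function.Periodic x₀ S → T ≤ S
  isolated : ∃ U : Set Plane, IsOpen U ∧ range x₀ ⊆ U ∧
    ∀ (y : ℝ → Plane) (S : ℝ), IsSolution ψ y → 0 < S → Function.Periodic y S →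
      (∃ a b, y a ≠ y b) → range y ⊆ U → range y = range x₀

/-- The linear `T`-periodic system `y' = A(t) y` has exactly one characteristic multiplier equal
to `1`: for the fundamental solution `Y` with `Y(0) = I`, the number `1` is a simple root of the
characteristic polynomial of the monodromy operator `Y(T)`. -/
def HasSimpleMultiplierOne (A : ℝ → Plane →L[ℝ] Plane) (T : ℝ) : Prop :=
  ∃ Y : ℝ → Plane →L[ℝ] Plane,
    Y 0 = ContinuousLinearMap.id ℝ Plane ∧
    (∀ t, HasDerivAt Y ((A t).comp (Y t)) t) ∧
    (LinearMap.charpoly (Y T : Plane →ₗ[ℝ] Plane)).rootMultiplicity 1 = 1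

/-- `z` is an eigenfunction of the linear `T`-periodic system `z' = A(t) z` for the characteristic
multiplier `ρ`: a nontrivial solution with `z(t + T) = ρ z(t)`. -/
structure IsEigenfunction (A : ℝ → Plane →L[ℝ] Plane) (T ρ : ℝ) (z : ℝ → Plane) : Prop where
  solution : ∀ t, HasDerivAt z (A t (z t)) t
  multiplier : ∀ t, z (t + T) = ρ • z t
  nontrivial : ∃ t, z t ≠ 0

/-- The matrix `ψ'(x₀(t))` of the system linearized along `x₀`. -/
noncomputable def linearization (ψ : Plane → Plane) (x₀ : ℝ → Plane) (t : ℝ) :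
    Plane →L[ℝ] Plane :=
  fderiv ℝ ψ (x₀ t)

/-- The matrix `-(ψ'(x₀(t)))*` of the adjoint system. -/
noncomputable def adjointLinearization (ψ : Plane → Plane) (x₀ : ℝ → Plane) (t : ℝ) :
    Plane →L[ℝ] Plane :=
  -ContinuousLinearMap.adjoint (linearization ψ x₀ t)

/-- The bifurcation function
`f₁(θ, s) = ∫_{s-T}^{s} ⟨z₁(τ), φ(τ - θ, x₀(τ), 0)⟩ dτ`. -/
noncomputable def f₁ (φ : ℝ → Plane → ℝ → Plane) (x₀ z₁ : ℝ → Plane) (T θ s : ℝ) : ℝ :=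
  ∫ τ in (s - T)..s, inner ℝ (z₁ τ) (φ (τ - θ) (x₀ τ) 0)

/-- Clockwise rotation of a vector by `π / 2`. -/
noncomputable def perp (a : Plane) : Plane := !₂[a 1, -a 0]

/-- `h(t, r) = x₀(t) + r z₀(t)^⊥ / ‖z₀(t)^⊥‖`. -/
noncomputable def h (x₀ z₀ : ℝ → Plane) (t r : ℝ) : Plane :=
  x₀ t + (r / ‖perp (z₀ t)‖) • perp (z₀ t)

/-- `Ω(T, 0, ξ) = η`: the solution of `x' = ψ(x)` starting at `ξ` at time `0` exists on `[0, T]`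
and has the value `η` at time `T`. (A relation, because solutions may blow up before time `T`.) -/
def IsFlowValue (ψ : Plane → Plane) (T : ℝ) (ξ η : Plane) : Prop :=
  ∃ u : ℝ → Plane, u 0 = ξ ∧ u T = η ∧
    ∀ s ∈ Icc 0 T, HasDerivWithinAt u (ψ (u s)) (Icc 0 T) s

/-- The arc `I(t, [-r₀, r₀])`, where `I(t, r) = Ω(T, 0, h(t, r))`. -/
def arc (ψ : Plane → Plane) (x₀ z₀ : ℝ → Plane) (T t r₀ : ℝ) : Set Plane :=
  {η | ∃ r ∈ Icc (-r₀) r₀, IsFlowValue ψ T (h x₀ z₀ t r) η}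

/-- The shifts `θ_ε(t)` tend to `θ₀` as `ε → 0+` uniformly in `t ∈ [0, T]`, and the point
`x_ε(t - θ_ε(t))` lies on `I(t, [-r₀, r₀])` for all `ε ∈ (0, ε₀)` and `t ∈ [0, T]`. -/
structure IsShiftFamily (ψ : Plane → Plane) (x₀ z₀ : ℝ → Plane) (T θ₀ r₀ ε₀ : ℝ)
    (x : ℝ → ℝ → Plane) (θ : ℝ → ℝ → ℝ) : Prop where
  tendsto : TendstoUniformlyOn θ (fun _ => θ₀) (𝓝[>] 0) (Icc 0 T)
  mem_arc : ∀ ε ∈ Ioo 0 ε₀, ∀ t ∈ Icc 0 T, x ε (t - θ ε t) ∈ arc ψ x₀ z₀ T t r₀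

end LimitCycle

namespace LimitCycle

/-! ### Comparison estimates, truncation and linearization in normed spaces -/

section General

variable {E : Type*} [NormedAddCommGroup E] [NormedSpace ℝ E]

/-! Let `w = x_ε(t - θ_ε(t)) - x₀(t)`. The displacement is measured by pairing it with the two
adjoint eigenfunctions. If `u` solves `u' = ψ(u) + e`, the derivative of `⟨z, u - x₀⟩` for an
adjoint solution `z` is `⟨z, e⟩` plus a Taylor remainder of `ψ`, which is `o(‖u - x₀‖)`
(`abs_inner_increment_sub_integral_le`).

Take `z = z₀` along the unperturbed trajectory that ends on the arc. It starts on the line through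
`x₀(t)` orthogonal to `z₀(t)`, so its initial pairing is zero, and `⟨z₀(t), w⟩ = o(‖w‖)`
(`abs_inner_sub_le_of_mem_arc`). Take `z = z₁` along one period of the shifted `x_ε`. Periodicity
makes the increment `(ρ - 1)⟨z₁(t - T), w⟩`, which equals `ε f₁(θ₀, t) + o(‖w‖ + ε)`
(`abs_inner_sub_le_of_periodic`). As `ρ ≠ 1`, `z₀` and `z₁` are independent at each time, so the two
pairings control `‖w‖` uniformly. Where `f₁` vanishes, `‖w‖ = o(‖w‖ + ε)`, and absorbing gives
`o(ε)`.

Shifts exist because `c = ⟨z₀, ψ(x₀)⟩` is a nonzero constant: the periodic orbit, carried back by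
the time-`T` flow, crosses the line orthogonal to `z₀(t)` transversally, and the intermediate value
theorem finds the crossing (`exists_shift_mem_arc`). Since `ψ` is only `C¹` and may have blow-up,
flow arguments use a bounded Lipschitz truncation `g` that agrees with `ψ` near the cycle. -/

theorem norm_sub_le_of_approx_solution {g : E → E} {L : NNReal} (hg : LipschitzWith L g)
    {a b : ℝ} {u y f : ℝ → E} {m C : ℝ}
    (hu : ∀ s ∈ Icc a b, HasDerivWithinAt u (f s) (Icc a b) s)
    (hy : ∀ s ∈ Icc a b, HasDerivWithinAt y (g (y s)) (Icc a b) s)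
    (hf : ∀ s ∈ Icc a b, ‖u s - y s‖ ≤ 1 → ‖f s - g (u s)‖ ≤ m)
    (hC₀ : 0 < C) (hm : m < C) (ha : ‖u a - y a‖ ≤ C)
    (hC : C * Real.exp ((L + 1) * (b - a)) ≤ 1) :
    ∀ s ∈ Icc a b, ‖u s - y s‖ ≤ C * Real.exp ((L + 1) * (b - a)) := by
  have hmono : ∀ s ∈ Icc a b,
      C * Real.exp ((L + 1) * (s - a)) ≤ C * Real.exp ((L + 1) * (b - a)) := by
    intro s hs
    have := hs.2
    gcongr
  intro s hs
  refine le_trans ?_ (hmono s hs)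
  -- The barrier has rate `L + 1` instead of `L`: at a contact point its value is at least `C > m`,
  -- so the extra unit of rate strictly beats the defect `m`. The barrier stays below `1`, so the
  -- defect bound is needed only inside the unit tube.
  refine image_norm_le_of_norm_deriv_right_lt_deriv_boundary (a := a) (b := b)
    (f := fun s => u s - y s) (f' := fun s => f s - g (y s))
    (B := fun s => C * Real.exp ((L + 1) * (s - a)))
    (B' := fun s => (L + 1) * (C * Real.exp ((L + 1) * (s - a)))) ?_ ?_ ?_ ?_ ?_ hs
  · intro t ht
    exact ((hu t ht).sub (hy t ht)).continuousWithinAt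
  · intro t ht
    exact ((hu t (Ico_subset_Icc_self ht)).sub (hy t (Ico_subset_Icc_self ht))).mono_of_mem_nhdsWithin
      (Icc_mem_nhdsGE_of_mem ht)
  · simpa using ha
  · intro t
    have h1 : HasDerivAt (fun s => ((L : ℝ) + 1) * (s - a)) (L + 1) t := by
      simpa using ((hasDerivAt_id t).sub_const a).const_mul ((L : ℝ) + 1)
    convert! (h1.exp).const_mul C using 1
    ring
  · intro t ht heq
    have ht' := Ico_subset_Icc_self ht
    have h1 := hf t ht' (by rw [heq]; exact (hmono t ht').trans hC)
    have h2 : ‖g (u t) - g (y t)‖ ≤ L * ‖u t - y t‖ := hg.norm_sub_le _ _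
    have h3 : 1 ≤ Real.exp ((L + 1) * (t - a)) := by
      apply Real.one_le_exp
      have := ht.1
      have := L.coe_nonneg
      apply mul_nonneg <;> linarith
    have h4 : C ≤ C * Real.exp ((L + 1) * (t - a)) := le_mul_of_one_le_right hC₀.le h3
    calc ‖f t - g (y t)‖ = ‖(f t - g (u t)) + (g (u t) - g (y t))‖ := by congr 1; abel
      _ ≤ m + L * ‖u t - y t‖ := (norm_add_le _ _).trans (add_le_add h1 h2)
      _ < _ := by rw [heq]; linarith

theorem hasDerivWithinAt_reverse {g : E → E} {v : ℝ → E} {T : ℝ}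
    (hv : ∀ s ∈ Icc 0 T, HasDerivWithinAt v (g (v s)) (Icc 0 T) s) :
    ∀ s ∈ Icc 0 T,
      HasDerivWithinAt (fun s => v (T - s)) (-g (v (T - s))) (Icc 0 T) s := by
  intro s hs
  have hm : MapsTo (fun s => T - s) (Icc 0 T) (Icc 0 T) := by
    intro r hr
    exact ⟨by linarith [hr.2], by linarith [hr.1]⟩
  have h1 : HasDerivWithinAt (fun s : ℝ => T - s) (-1) (Icc 0 T) s :=
    ((hasDerivAt_id s).const_sub T).hasDerivWithinAt
  have h2 := (hv _ (hm hs)).scomp s h1 hm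
  rw [neg_smul, one_smul] at h2
  exact h2

theorem exists_solution_of_bounded_lipschitz [CompleteSpace E] {g : E → E} {L M : NNReal}
    (hg : LipschitzWith L g) (hM : ∀ x, ‖g x‖ ≤ M) {T : ℝ} (hT : 0 ≤ T) (ξ : E) :
    ∃ v : ℝ → E, v 0 = ξ ∧ ∀ s ∈ Icc 0 T, HasDerivWithinAt v (g (v s)) (Icc 0 T) s := by
  have hP : IsPicardLindelof (fun _ => g) (⟨0, left_mem_Icc.2 hT⟩ : Icc 0 T) ξ
      (M * ⟨T, hT⟩) 0 M L := by
    refine ⟨fun t _ => hg.lipschitzOnWith, fun x _ => continuousOn_const, fun t _ x _ => hM x, ?_⟩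
    rw [sub_self, sub_zero, max_eq_left hT]
    exact (sub_zero _).ge
  exact hP.exists_eq_forall_mem_Icc_hasDerivWithinAt₀

theorem exists_bounded_lipschitz_eqOn [FiniteDimensional ℝ E] {ψ : E → E} (hψ : ContDiff ℝ 1 ψ)
    (R : ℝ) : ∃ (g : E → E) (L M : NNReal), LipschitzWith L g ∧ (∀ x, ‖g x‖ ≤ M) ∧
      ∀ x, ‖x‖ ≤ R → g x = ψ x := by
  let χ : ContDiffBump (0 : E) := ⟨|R| + 1, |R| + 2, by positivity, by linarith⟩
  have hsm : ContDiff ℝ 1 (fun x => χ x • ψ x) := χ.contDiff.smul hψ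
  have hc : HasCompactSupport (fun x => χ x • ψ x) := χ.hasCompactSupport.smul_right
  obtain ⟨L, hL⟩ := hsm.lipschitzWith_of_hasCompactSupport hc one_ne_zero
  obtain ⟨M, hM⟩ := hc.exists_bound_of_continuous hsm.continuous
  refine ⟨_, L, M.toNNReal, hL, fun x => (hM x).trans (Real.le_coe_toNNReal M), fun x hx => ?_⟩
  have : χ x = 1 := χ.one_of_mem_closedBall (by
    simp only [Metric.mem_closedBall, dist_zero_right]
    have := le_abs_self R
    change ‖x‖ ≤ |R| + 1
    linarith)
  simp [this]

/-- The derivative is uniformly continuous on the ball of radius `R + 1`, so the mean value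
inequality gives one `δ` for all base points. -/
theorem exists_uniform_linearization_bound [FiniteDimensional ℝ E] {ψ : E → E}
    (hψ : ContDiff ℝ 1 ψ) (R : ℝ) {η : ℝ} (hη : 0 < η) :
    ∃ δ > 0, ∀ p q, ‖p‖ ≤ R → ‖q - p‖ ≤ δ →
      ‖ψ q - ψ p - fderiv ℝ ψ p (q - p)‖ ≤ η * ‖q - p‖ := by
  have hc : UniformContinuousOn (fderiv ℝ ψ) (Metric.closedBall 0 (R + 1)) :=
    (isCompact_closedBall _ _).uniformContinuousOn_of_continuous
      (hψ.continuous_fderiv one_ne_zero).continuousOn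
  obtain ⟨δ, hδ, h⟩ := Metric.uniformContinuousOn_iff.1 hc η hη
  refine ⟨min (δ / 2) 1, by positivity, fun p q hp hq => ?_⟩
  have hq1 := hq.trans (min_le_left _ _)
  have hq2 := hq.trans (min_le_right _ _)
  refine (convex_closedBall p ‖q - p‖).norm_image_sub_le_of_norm_fderiv_le' (𝕜 := ℝ)
    (fun x _ => (hψ.differentiable one_ne_zero) x) (fun x hx => ?_)
    (Metric.mem_closedBall_self (norm_nonneg _)) (by simp [dist_eq_norm])
  rw [Metric.mem_closedBall, dist_eq_norm] at hx
  rw [← dist_eq_norm]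
  refine (h x ?_ p ?_ ?_).le
  · rw [mem_closedBall_zero_iff]
    calc ‖x‖ = ‖p + (x - p)‖ := by congr 1; abel
      _ ≤ _ := (norm_add_le _ _).trans (by linarith)
  · rw [mem_closedBall_zero_iff]
    linarith
  · rw [dist_eq_norm]
    linarith

theorem eq_zero_of_linear_solution {B : ℝ → E →L[ℝ] E} {K : ℝ}
    (hB : ∀ t, ‖B t‖ ≤ K) {y : ℝ → E} (hy : ∀ t, HasDerivAt y (B t (y t)) t) {t₀ : ℝ}
    (h₀ : y t₀ = 0) : ∀ t, y t = 0 := by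
  have : y = fun _ => 0 := by
    refine ODE_solution_unique_univ (v := fun t x => B t x) (s := fun _ => univ)
      (K := K.toNNReal) (t₀ := t₀) (fun t => ?_) (fun t => ⟨hy t, trivial⟩)
      (fun t => ⟨by simpa using hasDerivAt_const t (0 : E), trivial⟩) h₀
    exact ((B t).lipschitz.weaken (by
      rw [← NNReal.coe_le_coe]
      exact (hB t).trans (Real.le_coe_toNNReal K))).lipschitzOnWith
  exact fun t => congrFun this t

end General

/-! ### Plane geometry and the adjoint eigenfunctions -/

section

theorem plane_inner_eq (a b : Plane) : inner ℝ a b = a 0 * b 0 + a 1 * b 1 := by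
  simp [PiLp.inner_apply, Fin.sum_univ_two, mul_comm]

theorem plane_eq_zero_iff (a : Plane) : a = 0 ↔ a 0 = 0 ∧ a 1 = 0 := by
  constructor
  · rintro rfl
    simp
  · rintro ⟨h0, h1⟩
    ext i
    fin_cases i <;> simpa

theorem exists_eq_smul_of_inner_eq_zero {a b w : Plane} (hw : w ≠ 0) (hb : b ≠ 0)
    (ha0 : inner ℝ a w = 0) (hb0 : inner ℝ b w = 0) : ∃ c : ℝ, a = c • b := by
  rw [plane_inner_eq] at ha0 hb0
  have hdet : a 0 * b 1 = a 1 * b 0 := by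
    have h0 : (a 0 * b 1 - a 1 * b 0) * w 0 = 0 := by linear_combination b 1 * ha0 - a 1 * hb0
    have h1 : (a 0 * b 1 - a 1 * b 0) * w 1 = 0 := by linear_combination a 0 * hb0 - b 0 * ha0
    by_contra hne
    have hne' := sub_ne_zero.2 hne
    exact hw ((plane_eq_zero_iff w).2 ⟨(mul_eq_zero.1 h0).resolve_left hne',
      (mul_eq_zero.1 h1).resolve_left hne'⟩)
  have hn : b 0 ^ 2 + b 1 ^ 2 ≠ 0 := by
    intro h
    exact hb ((plane_eq_zero_iff b).2 ⟨by nlinarith [sq_nonneg (b 0), sq_nonneg (b 1)],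
      by nlinarith [sq_nonneg (b 0), sq_nonneg (b 1)]⟩)
  refine ⟨(a 0 * b 0 + a 1 * b 1) / (b 0 ^ 2 + b 1 ^ 2), ?_⟩
  ext i
  fin_cases i
  · simp only [Fin.zero_eta, PiLp.smul_apply, smul_eq_mul]
    field_simp
    linear_combination b 1 * hdet
  · simp only [Fin.mk_one, PiLp.smul_apply, smul_eq_mul]
    field_simp
    linear_combination -b 0 * hdet

theorem inner_perp (a : Plane) : inner ℝ a (perp a) = 0 := by
  rw [plane_inner_eq]
  simp [perp]
  ring

theorem perp_ne_zero {a : Plane} (ha : a ≠ 0) : perp a ≠ 0 := by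
  intro h
  rw [plane_eq_zero_iff] at h
  exact ha ((plane_eq_zero_iff a).2 ⟨by simpa [perp] using h.2, by simpa [perp] using h.1⟩)

variable {ψ : Plane → Plane} {x₀ : ℝ → Plane} {T : ℝ}

theorem inner_h_sub (z₀ : ℝ → Plane) (t r : ℝ) :
    inner ℝ (z₀ t) (h x₀ z₀ t r - x₀ t) = 0 := by
  simp [h, inner_smul_right, inner_perp]

theorem norm_h_sub {z₀ : ℝ → Plane} {t : ℝ} (hz : z₀ t ≠ 0) (r : ℝ) :
    ‖h x₀ z₀ t r - x₀ t‖ = |r| := by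
  have := norm_ne_zero_iff.2 (perp_ne_zero hz)
  simp [h, norm_smul, this]

theorem exists_eq_h {z₀ : ℝ → Plane} {t : ℝ} (hz : z₀ t ≠ 0) {p : Plane}
    (hp : inner ℝ (z₀ t) (p - x₀ t) = 0) : ∃ r, p = h x₀ z₀ t r := by
  obtain ⟨c, hc⟩ := exists_eq_smul_of_inner_eq_zero hz (perp_ne_zero hz)
    (by rwa [real_inner_comm]) (by rw [real_inner_comm]; exact inner_perp (z₀ t))
  refine ⟨c * ‖perp (z₀ t)‖, ?_⟩
  have := norm_ne_zero_iff.2 (perp_ne_zero hz)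
  rw [h, mul_div_cancel_right₀ _ this, ← hc]
  abel

theorem IsLimitCycle.continuous (hx₀ : IsLimitCycle ψ x₀ T) : Continuous x₀ :=
  continuous_iff_continuousAt.2 fun t => (hx₀.solution t).continuousAt

theorem IsLimitCycle.exists_norm_le (hx₀ : IsLimitCycle ψ x₀ T) : ∃ R, ∀ t, ‖x₀ t‖ ≤ R := by
  have hc := hx₀.periodic.compact_of_continuous hx₀.period_pos.ne' hx₀.continuous
  obtain ⟨R, hR⟩ := hc.isBounded.exists_norm_le
  exact ⟨R, fun t => hR _ (mem_range_self t)⟩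

theorem IsLimitCycle.exists_norm_linearization_le (hψ : ContDiff ℝ 1 ψ)
    (hx₀ : IsLimitCycle ψ x₀ T) : ∃ K, ∀ t, ‖linearization ψ x₀ t‖ ≤ K := by
  have hc := hx₀.periodic.compact_of_continuous hx₀.period_pos.ne' hx₀.continuous
  obtain ⟨K, hK⟩ := hc.exists_bound_of_continuousOn
    (hψ.continuous_fderiv one_ne_zero).continuousOn
  exact ⟨K, fun t => hK _ (mem_range_self t)⟩

theorem hasDerivAt_velocity (hψ : ContDiff ℝ 1 ψ) (hx₀ : IsSolution ψ x₀) (t : ℝ) :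
    HasDerivAt (fun s => ψ (x₀ s)) (linearization ψ x₀ t (ψ (x₀ t))) t :=
  ((hψ.differentiable one_ne_zero) (x₀ t)).hasFDerivAt.comp_hasDerivAt t (hx₀ t)

/-- The velocity solves the variational equation, so one zero forces it to vanish identically; then
`x₀` is constant and `T / 2` is a smaller period. -/
theorem IsLimitCycle.velocity_ne_zero (hψ : ContDiff ℝ 1 ψ) (hx₀ : IsLimitCycle ψ x₀ T) (t : ℝ) :
    ψ (x₀ t) ≠ 0 := by
  intro h0
  obtain ⟨K, hK⟩ := hx₀.exists_norm_linearization_le hψ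
  have hz := eq_zero_of_linear_solution hK (hasDerivAt_velocity hψ hx₀.solution) h0
  have hconst : ∀ a b, x₀ a = x₀ b :=
    is_const_of_deriv_eq_zero (fun s => (hx₀.solution s).differentiableAt)
      (fun s => by rw [(hx₀.solution s).deriv, hz s])
  have hT := hx₀.period_pos
  have := hx₀.smallest (T / 2) (by linarith) (fun s => hconst _ _)
  linarith

theorem hasDerivWithinAt_inner_adjoint {z w : ℝ → Plane} {F : Plane} {S : Set ℝ} {t : ℝ}
    (hz : HasDerivAt z (adjointLinearization ψ x₀ t (z t)) t) (hw : HasDerivWithinAt w F S t) :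
    HasDerivWithinAt (fun s => (inner ℝ (z s) (w s) : ℝ))
      (inner ℝ (z t) (F - linearization ψ x₀ t (w t))) S t := by
  convert! hz.hasDerivWithinAt.inner ℝ hw using 1
  rw [inner_sub_right, sub_eq_add_neg]
  simp [adjointLinearization, ContinuousLinearMap.adjoint_inner_left, inner_neg_left]

theorem inner_velocity_const (hψ : ContDiff ℝ 1 ψ) (hx₀ : IsSolution ψ x₀) {z : ℝ → Plane}
    (hz : ∀ t, HasDerivAt z (adjointLinearization ψ x₀ t (z t)) t) (s t : ℝ) :
    (inner ℝ (z s) (ψ (x₀ s)) : ℝ) = inner ℝ (z t) (ψ (x₀ t)) := by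
  have hd : ∀ t, HasDerivAt (fun s => (inner ℝ (z s) (ψ (x₀ s)) : ℝ)) 0 t := by
    intro t
    have := hasDerivWithinAt_inner_adjoint (hz t) (hasDerivAt_velocity hψ hx₀ t).hasDerivWithinAt
      (S := univ)
    rw [sub_self, inner_zero_right, hasDerivWithinAt_univ] at this
    exact this
  exact is_const_of_deriv_eq_zero (fun s => (hd s).differentiableAt) (fun s => (hd s).deriv) s t

/-- The pairing is constant in time, yet a shift by `T` multiplies it by `ρ`. -/
theorem inner_velocity_eq_zero (hψ : ContDiff ℝ 1 ψ) (hx₀ : IsLimitCycle ψ x₀ T) {z : ℝ → Plane}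
    {ρ : ℝ} (hρ : ρ ≠ 1) (hz : IsEigenfunction (adjointLinearization ψ x₀) T ρ z) (t : ℝ) :
    (inner ℝ (z t) (ψ (x₀ t)) : ℝ) = 0 := by
  have h1 := inner_velocity_const hψ hx₀.solution hz.solution (t + T) t
  rw [hz.multiplier, hx₀.periodic, real_inner_smul_left] at h1
  have h2 : (ρ - 1) * (inner ℝ (z t) (ψ (x₀ t)) : ℝ) = 0 := by linear_combination h1
  exact (mul_eq_zero.1 h2).resolve_left (sub_ne_zero.2 hρ)

theorem IsLimitCycle.exists_norm_adjoint_le (hψ : ContDiff ℝ 1 ψ)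
    (hx₀ : IsLimitCycle ψ x₀ T) : ∃ K, ∀ t, ‖adjointLinearization ψ x₀ t‖ ≤ K := by
  obtain ⟨K, hK⟩ := hx₀.exists_norm_linearization_le hψ
  refine ⟨K, fun t => ?_⟩
  rw [adjointLinearization, norm_neg, LinearIsometryEquiv.norm_map]
  exact hK t

theorem IsEigenfunction.ne_zero {B : ℝ → Plane →L[ℝ] Plane} {K ρ : ℝ} {z : ℝ → Plane}
    (hB : ∀ t, ‖B t‖ ≤ K) (hz : IsEigenfunction B T ρ z) (t : ℝ) : z t ≠ 0 := by
  intro h0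
  obtain ⟨s, hs⟩ := hz.nontrivial
  exact hs (eq_zero_of_linear_solution hB hz.solution h0 s)

theorem IsEigenfunction.continuous {B : ℝ → Plane →L[ℝ] Plane} {ρ : ℝ} {z : ℝ → Plane}
    (hz : IsEigenfunction B T ρ z) : Continuous z :=
  continuous_iff_continuousAt.2 fun t => (hz.solution t).continuousAt

/-- In the plane, two vectors orthogonal to a nonzero `w` are parallel. Then `z₀ = c z₁` at one
time, hence at all times by uniqueness, and comparing multipliers one period later contradicts `ρ ≠
1`. -/
theorem eq_zero_of_inner_eigenfunctions {B : ℝ → Plane →L[ℝ] Plane} {K ρ : ℝ}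
    {z₀ z₁ : ℝ → Plane} (hB : ∀ t, ‖B t‖ ≤ K) (hz₀ : IsEigenfunction B T 1 z₀) (hρ : ρ ≠ 1)
    (hz₁ : IsEigenfunction B T ρ z₁) {t : ℝ} {w : Plane} (h₀ : inner ℝ (z₀ t) w = (0 : ℝ))
    (h₁ : inner ℝ (z₁ t) w = (0 : ℝ)) : w = 0 := by
  by_contra hw
  obtain ⟨c, hc⟩ := exists_eq_smul_of_inner_eq_zero hw (hz₁.ne_zero hB t) h₀ h₁
  have hy : ∀ s, HasDerivAt (fun s => z₀ s - c • z₁ s) (B s (z₀ s - c • z₁ s)) s := by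
    intro s
    convert! (hz₀.solution s).sub ((hz₁.solution s).const_smul c) using 1
    simp
  have hT : z₀ (t + T) - c • z₁ (t + T) = 0 :=
    eq_zero_of_linear_solution hB hy (t₀ := t) (by simp [← hc]) (t + T)
  rw [hz₀.multiplier, hz₁.multiplier, one_smul, hc, smul_smul, ← sub_smul, smul_eq_zero] at hT
  rcases hT with hT | hT
  · have h2 : c * (1 - ρ) = 0 := by linear_combination hT
    rcases mul_eq_zero.1 h2 with h3 | h3
    · exact hz₀.ne_zero hB t (by rw [hc, h3, zero_smul])
    · exact hρ (by linarith)
  · exact hz₁.ne_zero hB t hT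

/-- Independence made quantitative, by compactness of the time interval times the unit sphere and
homogeneity in `w`. -/
theorem exists_lower_bound_inner_eigenfunctions {B : ℝ → Plane →L[ℝ] Plane} {K ρ : ℝ}
    {z₀ z₁ : ℝ → Plane} (hB : ∀ t, ‖B t‖ ≤ K) (hz₀ : IsEigenfunction B T 1 z₀) (hρ : ρ ≠ 1)
    (hz₁ : IsEigenfunction B T ρ z₁) (a b : ℝ) :
    ∃ m > 0, ∀ t ∈ Icc a b, ∀ w : Plane,
      m * ‖w‖ ≤ |inner ℝ (z₀ t) w| + |inner ℝ (z₁ t) w| := by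
  let F : ℝ × Plane → ℝ := fun p => |inner ℝ (z₀ p.1) p.2| + |inner ℝ (z₁ p.1) p.2|
  have hF : Continuous F := by
    have := hz₀.continuous
    have := hz₁.continuous
    fun_prop
  have hpos : ∀ p ∈ Icc a b ×ˢ Metric.sphere (0 : Plane) 1, 0 < F p := by
    rintro ⟨t, w⟩ ⟨-, hw⟩
    by_contra hneg
    have h1 : |(inner ℝ (z₀ t) w : ℝ)| + |(inner ℝ (z₁ t) w : ℝ)| ≤ 0 := not_lt.1 hneg
    have h2 := abs_nonneg (inner ℝ (z₀ t) w : ℝ)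
    have h3 := abs_nonneg (inner ℝ (z₁ t) w : ℝ)
    have h4 : w = 0 := eq_zero_of_inner_eigenfunctions hB hz₀ hρ hz₁ (t := t)
      (abs_eq_zero.1 (by linarith)) (abs_eq_zero.1 (by linarith))
    simp [h4] at hw
  obtain ⟨m, hm, hle⟩ := (isCompact_Icc.prod (isCompact_sphere (0 : Plane) 1)).exists_forall_le'
    hF.continuousOn (a := 0) hpos
  refine ⟨m, hm, fun t ht w => ?_⟩
  rcases eq_or_ne w 0 with rfl | hw
  · simp
  have hn := norm_pos_iff.2 hw
  have h1 := hle (t, ‖w‖⁻¹ • w) ⟨ht, by simp [norm_smul, hn.ne']⟩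
  simp only [F, inner_smul_right, abs_mul, abs_inv, abs_norm] at h1
  rw [← mul_add, ← div_eq_inv_mul, le_div_iff₀ hn] at h1
  exact h1

end

/-! ### Bounds on the perturbation and closeness of the perturbed solutions -/

section

variable {ψ : Plane → Plane} {x₀ : ℝ → Plane} {T : ℝ} {φ : ℝ → Plane → ℝ → Plane}

theorem exists_norm_perturbation_le
    (hφ : ContinuousOn (fun p : ℝ × Plane × ℝ => φ p.1 p.2.1 p.2.2) (univ ×ˢ univ ×ˢ Icc 0 1))
    (hT : 0 < T) (hφT : ∀ t v, ∀ ε ∈ Icc (0 : ℝ) 1, φ (t + T) v ε = φ t v ε) (R : ℝ) :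
    ∃ M, 0 ≤ M ∧ ∀ t v, ‖v‖ ≤ R → ∀ ε ∈ Icc (0 : ℝ) 1, ‖φ t v ε‖ ≤ M := by
  have hc : IsCompact (Icc 0 T ×ˢ Metric.closedBall (0 : Plane) R ×ˢ Icc (0 : ℝ) 1) :=
    isCompact_Icc.prod ((isCompact_closedBall _ _).prod isCompact_Icc)
  obtain ⟨M, hM⟩ := hc.exists_bound_of_continuousOn
    (hφ.mono (prod_mono (subset_univ _) (prod_mono (subset_univ _) subset_rfl)))
  refine ⟨|M|, abs_nonneg _, fun t v hv ε hε => ?_⟩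
  have hper : Function.Periodic (fun t => φ t v ε) T := fun t => hφT t v ε hε
  obtain ⟨s, hs, hts⟩ := hper.exists_mem_Ico₀ hT t
  rw [hts]
  exact (hM (s, v, ε) ⟨Ico_subset_Icc_self hs, by simpa using hv, hε⟩).trans (le_abs_self M)

theorem exists_uniform_perturbation_modulus
    (hφ : ContinuousOn (fun p : ℝ × Plane × ℝ => φ p.1 p.2.1 p.2.2) (univ ×ˢ univ ×ˢ Icc 0 1))
    (R a b θ₀ : ℝ) {η : ℝ} (hη : 0 < η) :
    ∃ δ > 0, ∀ s ∈ Icc a b, ∀ θ, |θ - θ₀| ≤ δ → ∀ v p, ‖p‖ ≤ R → ‖v - p‖ ≤ δ →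
      ∀ ε ∈ Icc (0 : ℝ) 1, ε ≤ δ → ‖φ (s - θ) v ε - φ (s - θ₀) p 0‖ ≤ η := by
  have hc : IsCompact (Icc (a - θ₀ - 1) (b - θ₀ + 1) ×ˢ
      Metric.closedBall (0 : Plane) (R + 1) ×ˢ Icc (0 : ℝ) 1) :=
    isCompact_Icc.prod ((isCompact_closedBall _ _).prod isCompact_Icc)
  obtain ⟨δ, hδ, hu⟩ := Metric.uniformContinuousOn_iff.1 (hc.uniformContinuousOn_of_continuous
    (hφ.mono (prod_mono (subset_univ _) (prod_mono (subset_univ _) subset_rfl)))) η hη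
  refine ⟨min (δ / 2) 1, by positivity, fun s hs θ hθ v p hp hv ε hε hεδ => ?_⟩
  have hθ1 := hθ.trans (min_le_left _ _)
  have hθ2 := abs_le.1 (hθ.trans (min_le_right _ _))
  have hv1 := hv.trans (min_le_left _ _)
  have hv2 := hv.trans (min_le_right _ _)
  have hε1 := hεδ.trans (min_le_left _ _)
  have hvR : ‖v‖ ≤ R + 1 := by
    calc ‖v‖ = ‖p + (v - p)‖ := by congr 1; abel
      _ ≤ _ := (norm_add_le _ _).trans (by linarith)
  rw [← dist_eq_norm]
  refine (hu (s - θ, v, ε) ⟨⟨?_, ?_⟩, by simpa using hvR, hε⟩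
    (s - θ₀, p, 0) ⟨⟨?_, ?_⟩, ?_, by simp⟩ ?_).le
  · linarith [hs.1]
  · linarith [hs.2]
  · linarith [hs.1]
  · linarith [hs.2]
  · simpa using hp.trans (by linarith)
  · simp only [Prod.dist_eq, max_lt_iff]
    refine ⟨?_, ?_, ?_⟩
    · rw [Real.dist_eq, show s - θ - (s - θ₀) = -(θ - θ₀) by ring, abs_neg]
      linarith
    · rw [dist_eq_norm]
      linarith
    · rw [Real.dist_eq, sub_zero, abs_of_nonneg hε.1]
      linarith

theorem norm_perturbed_sub_le {g : Plane → Plane} {L : NNReal} (hg : LipschitzWith L g) {R M : ℝ}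
    (hx₀ : IsSolution ψ x₀) (hR : ∀ t, ‖x₀ t‖ ≤ R) (hgψ : ∀ v, ‖v‖ ≤ R + 1 → g v = ψ v)
    (hM : ∀ t v, ‖v‖ ≤ R + 1 → ∀ ε ∈ Icc (0 : ℝ) 1, ‖φ t v ε‖ ≤ M)
    {ε : ℝ} (hε : ε ∈ Icc (0 : ℝ) 1) {x : ℝ → Plane} (hx : IsPerturbedSolution ψ φ ε x)
    {θ a b C : ℝ} (hC₀ : 0 < C) (hεC : ε * M < C) (ha : ‖x (a - θ) - x₀ a‖ ≤ C)
    (hC : C * Real.exp ((L + 1) * (b - a)) ≤ 1) :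
    ∀ s ∈ Icc a b, ‖x (s - θ) - x₀ s‖ ≤ C * Real.exp ((L + 1) * (b - a)) := by
  refine norm_sub_le_of_approx_solution hg (u := fun s => x (s - θ))
    (f := fun s => ψ (x (s - θ)) + ε • φ (s - θ) (x (s - θ)) ε) (m := ε * M)
    (fun s _ => ((hx (s - θ)).comp_sub_const s θ).hasDerivWithinAt)
    (fun s _ => ?_) (fun s _ hs => ?_) hC₀ hεC ha hC
  · rw [hgψ _ (by linarith [hR s])]
    exact (hx₀ s).hasDerivWithinAt
  · have hv : ‖x (s - θ)‖ ≤ R + 1 := by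
      calc ‖x (s - θ)‖ = ‖x₀ s + (x (s - θ) - x₀ s)‖ := by congr 1; abel
        _ ≤ _ := (norm_add_le _ _).trans (add_le_add (hR s) hs)
    rw [hgψ _ hv, add_sub_cancel_left, norm_smul, Real.norm_of_nonneg hε.1]
    exact mul_le_mul_of_nonneg_left (hM _ _ hv _ hε) hε.1

/-- Convergence at the single time `0` suffices: the comparison estimate carries it over one period,
and periodicity extends it to the whole line. -/
theorem eventually_norm_perturbed_sub_le {g : Plane → Plane} {L : NNReal}
    (hg : LipschitzWith L g) {R M : ℝ}
    (hx₀ : IsLimitCycle ψ x₀ T) (hR : ∀ t, ‖x₀ t‖ ≤ R) (hgψ : ∀ v, ‖v‖ ≤ R + 1 → g v = ψ v)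
    (hM : ∀ t v, ‖v‖ ≤ R + 1 → ∀ ε ∈ Icc (0 : ℝ) 1, ‖φ t v ε‖ ≤ M)
    {x : ℝ → ℝ → Plane} {θ₀ : ℝ}
    (hx : ∀ᶠ ε in 𝓝[>] (0 : ℝ),
      IsPerturbedSolution ψ φ ε (x ε) ∧ Function.Periodic (x ε) T)
    (hconv : Tendsto (fun ε => x ε (0 - θ₀)) (𝓝[>] 0) (𝓝 (x₀ 0))) {η : ℝ} (hη : 0 < η) :
    ∀ᶠ ε in 𝓝[>] (0 : ℝ), ∀ s, ‖x ε (s - θ₀) - x₀ s‖ ≤ η := by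
  set D := Real.exp (((L : ℝ) + 1) * (T - 0)) with hD
  have hD0 : 0 < D := Real.exp_pos _
  set C := min η 1 / D with hCdef
  have hC0 : 0 < C := by positivity
  have hCD : C * D = min η 1 := div_mul_cancel₀ _ hD0.ne'
  have h1 : ∀ᶠ ε in 𝓝[>] (0 : ℝ), ‖x ε (0 - θ₀) - x₀ 0‖ < C := by
    simpa [dist_eq_norm] using (Metric.tendsto_nhds.1 hconv C hC0)
  have h2 : ∀ᶠ ε in 𝓝[>] (0 : ℝ), ε * M < C := by
    have : Tendsto (fun ε : ℝ => ε * M) (𝓝[>] 0) (𝓝 (0 * M)) :=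
      (tendsto_id.mul_const M).mono_left nhdsWithin_le_nhds
    exact this.eventually_lt_const (by simpa using hC0)
  have h3 : ∀ᶠ ε in 𝓝[>] (0 : ℝ), ε ∈ Ioo (0 : ℝ) 1 := Ioo_mem_nhdsGT one_pos
  filter_upwards [h1, h2, h3, hx] with ε h1 h2 h3 hx s
  have hper : Function.Periodic (fun s => x ε (s - θ₀) - x₀ s) T := by
    intro s
    simp only
    rw [hx₀.periodic, show s + T - θ₀ = s - θ₀ + T by ring, hx.2]
  obtain ⟨r, hr, hsr⟩ := hper.exists_mem_Ico₀ hx₀.period_pos s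
  rw [hsr]
  have := norm_perturbed_sub_le hg hx₀.solution hR hgψ hM (Ioo_subset_Icc_self h3) hx.1 hC0 h2
    h1.le (b := T) (by rw [hCD]; exact min_le_right _ _) r (Ico_subset_Icc_self hr)
  rw [hCD] at this
  exact this.trans (min_le_left _ _)

end

/-! ### Existence of the arc and of points of nearby curves on it -/

section

theorem eventually_mul_le (a : ℝ) {b : ℝ} (hb : 0 < b) : ∀ᶠ d in 𝓝[>] (0 : ℝ), a * d ≤ b := by
  have : Tendsto (fun d : ℝ => a * d) (𝓝[>] 0) (𝓝 (a * 0)) :=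
    (tendsto_id.const_mul a).mono_left nhdsWithin_le_nhds
  exact this.eventually_le_const (by simpa using hb)

section General

variable {E : Type*} [NormedAddCommGroup E] [NormedSpace ℝ E]

theorem norm_sub_le_of_solutions {g : E → E} {L : NNReal} (hg : LipschitzWith L g)
    {u y : ℝ → E} {T : ℝ}
    (hu : ∀ s ∈ Icc 0 T, HasDerivWithinAt u (g (u s)) (Icc 0 T) s)
    (hy : ∀ s ∈ Icc 0 T, HasDerivWithinAt y (g (y s)) (Icc 0 T) s) :
    ∀ s ∈ Icc 0 T, ‖u s - y s‖ ≤ Real.exp (L * T) * ‖u 0 - y 0‖ := by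
  intro s hs
  have := dist_le_of_trajectories_ODE (v := fun _ => g) (fun _ => hg)
    (fun s hs => (hu s hs).continuousWithinAt)
    (fun s hs => (hu s (Ico_subset_Icc_self hs)).mono_of_mem_nhdsWithin (Icc_mem_nhdsGE_of_mem hs))
    (fun s hs => (hy s hs).continuousWithinAt)
    (fun s hs => (hy s (Ico_subset_Icc_self hs)).mono_of_mem_nhdsWithin (Icc_mem_nhdsGE_of_mem hs))
    le_rfl s hs
  rw [dist_eq_norm, dist_eq_norm, sub_zero, mul_comm] at this
  refine this.trans ?_
  have := hs.2
  gcongr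

theorem norm_taylor_le_of_solution {g : E → E} {L M : NNReal} (hg : LipschitzWith L g)
    (hM : ∀ v, ‖g v‖ ≤ M) {y : ℝ → E} (hy : ∀ s, HasDerivAt y (g (y s)) s) (t σ : ℝ) :
    ‖y (t + σ) - y t - σ • g (y t)‖ ≤ L * M * σ ^ 2 := by
  have hlip : ∀ r, ‖y (t + r) - y t‖ ≤ M * |r| := by
    intro r
    have := convex_univ.norm_image_sub_le_of_norm_hasDerivWithin_le (f := y) (C := M)
      (fun s _ => (hy s).hasDerivWithinAt) (fun s _ => hM _) (mem_univ t) (mem_univ (t + r))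
    simpa using this
  have := (convex_Icc (-|σ|) |σ|).norm_image_sub_le_of_norm_hasDerivWithin_le
    (f := fun r => y (t + r) - r • g (y t)) (f' := fun r => g (y (t + r)) - g (y t))
    (C := L * (M * |σ|)) (x := 0) (y := σ) (fun r _ => ?_) (fun r hr => ?_) ?_ ?_
  · simp only [add_zero, zero_smul, sub_zero, Real.norm_eq_abs] at this
    calc _ = ‖y (t + σ) - σ • g (y t) - y t‖ := by congr 1; abel
      _ ≤ _ := this
      _ = _ := by rw [← sq_abs σ]; ring
  · have h1 : HasDerivAt (fun r => y (t + r)) (g (y (t + r))) r := (hy (t + r)).comp_const_add t r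
    have h2 : HasDerivAt (fun r : ℝ => r • g (y t)) ((1 : ℝ) • g (y t)) r :=
      (hasDerivAt_id r).smul_const _
    rw [one_smul] at h2
    exact (h1.sub h2).hasDerivWithinAt
  · refine (hg.norm_sub_le _ _).trans ?_
    have h3 := abs_le.2 hr
    have := hlip r
    gcongr
    exact this.trans (by gcongr)
  · simp
  · exact ⟨neg_abs_le _, le_abs_self _⟩

end General

variable {ψ : Plane → Plane} {x₀ : ℝ → Plane} {T : ℝ}

theorem isFlowValue_of_near {g : Plane → Plane} {L M : NNReal} (hg : LipschitzWith L g)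
    (hgM : ∀ v, ‖g v‖ ≤ M) {R : ℝ} (hT : 0 < T) (hx₀ : IsSolution ψ x₀) (hR : ∀ t, ‖x₀ t‖ ≤ R)
    (hgψ : ∀ v, ‖v‖ ≤ R + 1 → g v = ψ v) {t : ℝ} {ξ : Plane}
    (hξ : Real.exp (L * T) * ‖ξ - x₀ t‖ ≤ 1) : ∃ η, IsFlowValue ψ T ξ η := by
  obtain ⟨v, hv0, hv⟩ := exists_solution_of_bounded_lipschitz hg hgM hT.le ξ
  refine ⟨v T, v, hv0, rfl, fun s hs => ?_⟩
  have hx : ∀ s ∈ Icc 0 T, HasDerivWithinAt (fun s => x₀ (t + s)) (g (x₀ (t + s))) (Icc 0 T) s := by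
    intro s _
    rw [hgψ _ (by linarith [hR (t + s)])]
    exact ((hx₀ (t + s)).comp_const_add t s).hasDerivWithinAt
  have h1 := norm_sub_le_of_solutions hg hv hx s hs
  simp only [add_zero, hv0] at h1
  rw [← hgψ]
  · exact hv s hs
  · calc ‖v s‖ = ‖x₀ (t + s) + (v s - x₀ (t + s))‖ := by congr 1; abel
      _ ≤ _ := (norm_add_le _ _).trans (add_le_add (hR _) (h1.trans hξ))

/-- A point lies on the arc when its backward time-`T` image lies on the line through `x₀(t)`
orthogonal to `z₀(t)`, within distance `r₀`. Along `u(t + σ)` the function that detects this line is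
close to `σ c`, so it changes sign. -/
theorem exists_shift_mem_arc {g : Plane → Plane} {L M : NNReal} (hg : LipschitzWith L g)
    (hgM : ∀ v, ‖g v‖ ≤ M) {R : ℝ} (hx₀ : IsLimitCycle ψ x₀ T) (hR : ∀ t, ‖x₀ t‖ ≤ R)
    (hgψ : ∀ v, ‖v‖ ≤ R + 1 → g v = ψ v) {z₀ : ℝ → Plane} (hz₀ : ∀ t, z₀ t ≠ 0) {Z : ℝ}
    (hZ : ∀ t ∈ Icc 0 T, ‖z₀ t‖ ≤ Z) {c : ℝ} (hc : c ≠ 0)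
    (hz₀c : ∀ t, inner ℝ (z₀ t) (ψ (x₀ t)) = c) {r₀ : ℝ} (hr₀ : 0 < r₀) (hr₀1 : r₀ ≤ 1)
    {δ : ℝ} (hδ : 0 < δ) :
    ∃ κ > 0, ∀ u : ℝ → Plane, Continuous u → (∀ s, ‖u s - x₀ s‖ ≤ κ) →
      ∀ t ∈ Icc 0 T, ∃ σ, |σ| ≤ δ ∧ u (t + σ) ∈ arc ψ x₀ z₀ T t r₀ := by
  have hT := hx₀.period_pos
  have hZ0 : 0 ≤ Z := (norm_nonneg _).trans (hZ 0 (left_mem_Icc.2 hT.le))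
  have hg₀ : ∀ s, HasDerivAt x₀ (g (x₀ s)) s := by
    intro s
    rw [hgψ _ (by linarith [hR s])]
    exact hx₀.solution s
  set D := Real.exp (L * T) with hD
  have hD0 : 0 < D := Real.exp_pos _
  have hc' := abs_pos.2 hc
  -- `d` is fixed first, so that the quadratic Taylor error is at most a quarter of `|c| d`; then
  -- `κ` is chosen depending on `d`, so that the error from replacing `x₀` by `u` is at most another
  -- quarter.
  obtain ⟨d, ⟨⟨hd1, hd2⟩, hd3⟩, hd0⟩ :=
    (((eventually_mul_le (Z * (L * M)) (by positivity : 0 < |c| / 4)).and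
      (eventually_mul_le M (by positivity : 0 < r₀ / 2))).and
      (eventually_mul_le 1 hδ)).and self_mem_nhdsWithin |>.exists
  rw [one_mul] at hd3
  obtain ⟨κ, ⟨hκ1, hκ2⟩, hκ0⟩ :=
    ((eventually_mul_le (Z * D) (by positivity : 0 < |c| * d / 4)).and
      (eventually_mul_le D (by positivity : 0 < r₀ / 2))).and self_mem_nhdsWithin |>.exists
  refine ⟨κ, hκ0, fun u hu hux t ht => ?_⟩
  have hgn : LipschitzWith L (fun v => -g v) := hg.neg
  -- `V ξ` is the trajectory of the reversed truncated field from `ξ`, so `V ξ T` is the backward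
  -- time-`T` image.
  choose V hV0 hV using
    fun ξ => exists_solution_of_bounded_lipschitz hgn (M := M) (by simpa using hgM) hT.le ξ
  have hback : ∀ τ, ∀ s ∈ Icc 0 T,
      HasDerivWithinAt (fun s => x₀ (τ - s)) (-g (x₀ (τ - s))) (Icc 0 T) s := by
    intro τ s _
    have h1 : HasDerivAt (fun s : ℝ => τ - s) (-1) s := (hasDerivAt_id s).const_sub τ
    have h2 := (hg₀ (τ - s)).scomp s h1
    rw [neg_smul, one_smul] at h2
    exact h2.hasDerivWithinAt
  have hVx : ∀ τ, ∀ s ∈ Icc 0 T, ‖V (u τ) s - x₀ (τ - s)‖ ≤ D * κ := by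
    intro τ s hs
    have h1 := norm_sub_le_of_solutions hgn (hV (u τ)) (hback τ) s hs
    simp only [hV0, sub_zero] at h1
    exact h1.trans (by gcongr; exact hux τ)
  have hTmem : T ∈ Icc 0 T := right_mem_Icc.2 hT.le
  have hPx : ∀ τ, ‖V (u τ) T - x₀ τ‖ ≤ D * κ := by
    intro τ
    have := hVx τ T hTmem
    rwa [hx₀.periodic.sub_eq] at this
  have hPcont : Continuous (fun ξ => V ξ T) := by
    refine (LipschitzWith.of_dist_le_mul (K := ⟨D, hD0.le⟩) fun ξ ξ' => ?_).continuous
    have := norm_sub_le_of_solutions hgn (hV ξ) (hV ξ') T hTmem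
    simp only [hV0] at this
    rw [dist_eq_norm, dist_eq_norm]
    exact this
  have hest : ∀ σ, |σ| ≤ d →
      |inner ℝ (z₀ t) (V (u (t + σ)) T - x₀ t) - σ * c| ≤ |c| * d / 2 := by
    intro σ hσ
    have h1 := norm_taylor_le_of_solution hg hgM hg₀ t σ
    have h2 := hPx (t + σ)
    have h3 : inner ℝ (z₀ t) (V (u (t + σ)) T - x₀ t) - σ * c =
        inner ℝ (z₀ t) ((V (u (t + σ)) T - x₀ (t + σ)) + (x₀ (t + σ) - x₀ t - σ • g (x₀ t))) := by
      rw [← hz₀c t, ← real_inner_smul_right, ← inner_sub_right, hgψ _ (by linarith [hR t])]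
      congr 1
      abel
    rw [h3]
    calc _ ≤ ‖z₀ t‖ * _ := abs_real_inner_le_norm _ _
      _ ≤ Z * (D * κ + L * M * d ^ 2) := by
        have h4 : σ ^ 2 ≤ d ^ 2 := sq_le_sq' (by linarith [abs_le.1 hσ]) (abs_le.1 hσ).2
        gcongr
        · exact hZ t ht
        · refine (norm_add_le _ _).trans (add_le_add h2 (h1.trans ?_))
          gcongr
      _ = Z * D * κ + (Z * (L * M) * d) * d := by ring
      _ ≤ |c| * d / 4 + |c| / 4 * d := by gcongr
      _ = _ := by ring
  -- The factor `c` makes the slope `c²` positive, so both signs of `c` are handled at once.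
  obtain ⟨σ, hσ, hσ0⟩ : ∃ σ ∈ Icc (-d) d, c * inner ℝ (z₀ t) (V (u (t + σ)) T - x₀ t) = 0 := by
    have hcont : Continuous fun σ => c * inner ℝ (z₀ t) (V (u (t + σ)) T - x₀ t) := by
      have : Continuous fun σ => V (u (t + σ)) T := hPcont.comp (by fun_prop)
      fun_prop
    refine intermediate_value_Icc (by linarith) hcont.continuousOn ⟨?_, ?_⟩
    · have h1 := hest (-d) (by rw [abs_neg, abs_of_pos hd0])
      have h2 := mul_le_mul_of_nonneg_left h1 hc'.le
      rw [← abs_mul] at h2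
      have h3 := (abs_le.1 h2).2
      have h4 : |c| * |c| = c * c := abs_mul_abs_self c
      have h5 : 0 ≤ c * c * d := mul_nonneg (mul_self_nonneg c) hd0.le
      have h6 : |c| * (|c| * d / 2) = c * c * d / 2 := by rw [← h4]; ring
      linarith
    · have h1 := hest d (by rw [abs_of_pos hd0])
      have h2 := mul_le_mul_of_nonneg_left h1 hc'.le
      rw [← abs_mul] at h2
      have h3 := (abs_le.1 h2).1
      have h4 : |c| * |c| = c * c := abs_mul_abs_self c
      have h5 : 0 ≤ c * c * d := mul_nonneg (mul_self_nonneg c) hd0.le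
      have h6 : |c| * (|c| * d / 2) = c * c * d / 2 := by rw [← h4]; ring
      linarith
  have hσd : |σ| ≤ d := abs_le.2 hσ
  refine ⟨σ, hσd.trans hd3, ?_⟩
  obtain ⟨r, hr⟩ := exists_eq_h (hz₀ t) ((mul_eq_zero.1 hσ0).resolve_left hc)
  have hrle : |r| ≤ r₀ := by
    rw [← norm_h_sub (x₀ := x₀) (hz₀ t), ← hr]
    have h1 : ‖x₀ (t + σ) - x₀ t‖ ≤ M * |σ| := by
      have := convex_univ.norm_image_sub_le_of_norm_hasDerivWithin_le (f := x₀) (C := M)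
        (fun s _ => (hg₀ s).hasDerivWithinAt) (fun s _ => hgM _) (mem_univ t) (mem_univ (t + σ))
      simpa using this
    calc _ = ‖(V (u (t + σ)) T - x₀ (t + σ)) + (x₀ (t + σ) - x₀ t)‖ := by congr 1; abel
      _ ≤ D * κ + M * |σ| := (norm_add_le _ _).trans (add_le_add (hPx _) h1)
      _ ≤ D * κ + M * d := by gcongr
      _ ≤ r₀ := by linarith
  refine ⟨r, abs_le.1 hrle, fun s => V (u (t + σ)) (T - s), ?_, ?_, fun s hs => ?_⟩
  · simpa using hr
  · simp [hV0]
  · have h1 := hasDerivWithinAt_reverse (g := fun v => -g v) (hV (u (t + σ))) s hs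
    rw [neg_neg, hgψ] at h1
    · exact h1
    · have h2 := hVx (t + σ) (T - s) ⟨by linarith [hs.2], by linarith [hs.1]⟩
      calc _ = ‖x₀ (t + σ - (T - s)) + (V (u (t + σ)) (T - s) - x₀ (t + σ - (T - s)))‖ := by
            congr 1; abel
        _ ≤ _ := (norm_add_le _ _).trans (add_le_add (hR _) (h2.trans (by linarith)))

end

/-! ### Pairing estimates along trajectories and selection of the shifts -/

section

variable {ψ : Plane → Plane} {x₀ : ℝ → Plane} {T : ℝ} {φ : ℝ → Plane → ℝ → Plane}

theorem abs_inner_increment_sub_integral_le (hx₀ : IsSolution ψ x₀) {R : ℝ}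
    (hR : ∀ t, ‖x₀ t‖ ≤ R) {z : ℝ → Plane}
    (hz : ∀ t, HasDerivAt z (adjointLinearization ψ x₀ t (z t)) t) {Z η δ μ W : ℝ} (hη : 0 ≤ η)
    (hlin : ∀ p q, ‖p‖ ≤ R → ‖q - p‖ ≤ δ →
      ‖ψ q - ψ p - fderiv ℝ ψ p (q - p)‖ ≤ η * ‖q - p‖)
    {a b : ℝ} (hab : a ≤ b) (hZ : ∀ s ∈ Icc a b, ‖z s‖ ≤ Z) {u e q : ℝ → Plane}
    (hq : Continuous q)
    (hu : ∀ s ∈ Icc a b, HasDerivWithinAt u (ψ (u s) + e s) (Icc a b) s)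
    (hW : ∀ s ∈ Icc a b, ‖u s - x₀ s‖ ≤ W) (hWδ : W ≤ δ)
    (he : ∀ s ∈ Icc a b, ‖e s - q s‖ ≤ μ) :
    |inner ℝ (z b) (u b - x₀ b) - inner ℝ (z a) (u a - x₀ a) - ∫ s in a..b, inner ℝ (z s) (q s)| ≤
      Z * (η * W + μ) * (b - a) := by
  have hzc : Continuous z := continuous_iff_continuousAt.2 fun t => (hz t).continuousAt
  have hc : Continuous fun s => (inner ℝ (z s) (q s) : ℝ) := hzc.inner hq
  have hZ0 : 0 ≤ Z := (norm_nonneg _).trans (hZ a (left_mem_Icc.2 hab))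
  have := norm_image_sub_le_of_norm_deriv_le_segment' (a := a) (b := b)
    (f := fun s => (inner ℝ (z s) (u s - x₀ s) : ℝ) - ∫ r in a..s, inner ℝ (z r) (q r))
    (f' := fun s => inner ℝ (z s) (ψ (u s) + e s - ψ (x₀ s) - linearization ψ x₀ s (u s - x₀ s)) -
      inner ℝ (z s) (q s)) (C := Z * (η * W + μ)) (fun s hs => ?_) (fun s hs => ?_) b
    (right_mem_Icc.2 hab)
  · rw [Real.norm_eq_abs, intervalIntegral.integral_same, sub_zero] at this
    convert this using 2
    ring
  · exact (hasDerivWithinAt_inner_adjoint (hz s)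
      ((hu s hs).sub (hx₀ s).hasDerivWithinAt)).sub
      (hc.integral_hasStrictDerivAt a s).hasDerivAt.hasDerivWithinAt
  · have hs' := Ico_subset_Icc_self hs
    rw [← inner_sub_right, Real.norm_eq_abs]
    refine (abs_real_inner_le_norm _ _).trans ?_
    gcongr
    · exact hZ s hs'
    · calc _ = ‖(ψ (u s) - ψ (x₀ s) - linearization ψ x₀ s (u s - x₀ s)) + (e s - q s)‖ := by
            congr 1; abel
        _ ≤ η * ‖u s - x₀ s‖ + μ :=
            (norm_add_le _ _).trans (add_le_add (hlin _ _ (hR s) ((hW s hs').trans hWδ)) (he s hs'))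
        _ ≤ _ := by
            have := hW s hs'
            gcongr

theorem abs_inner_sub_le_of_mem_arc {g : Plane → Plane} {L : NNReal} (hg : LipschitzWith L g)
    (hx₀ : IsLimitCycle ψ x₀ T) {R : ℝ} (hR : ∀ t, ‖x₀ t‖ ≤ R)
    (hgψ : ∀ v, ‖v‖ ≤ R + 1 → g v = ψ v) {z₀ : ℝ → Plane}
    (hz₀ : IsEigenfunction (adjointLinearization ψ x₀) T 1 z₀) {Z η δ : ℝ} (hη : 0 ≤ η)
    (hlin : ∀ p q, ‖p‖ ≤ R → ‖q - p‖ ≤ δ →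
      ‖ψ q - ψ p - fderiv ℝ ψ p (q - p)‖ ≤ η * ‖q - p‖) {t r₀ : ℝ}
    (hZ : ∀ s ∈ Icc (t - T) t, ‖z₀ s‖ ≤ Z) {ξ : Plane} (hξ : ξ ∈ arc ψ x₀ z₀ T t r₀)
    (h1 : ‖ξ - x₀ t‖ * Real.exp ((L + 1) * T) ≤ 1)
    (hδ : ‖ξ - x₀ t‖ * Real.exp ((L + 1) * T) ≤ δ) :
    |inner ℝ (z₀ t) (ξ - x₀ t)| ≤ Z * (η * (‖ξ - x₀ t‖ * Real.exp ((L + 1) * T))) * T := by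
  -- The comparison estimate, run below in reversed time with zero defect and `C = ‖ξ - x₀ t‖`,
  -- needs `C > 0`.
  rcases eq_or_ne (ξ - x₀ t) 0 with h0 | h0
  · simp [h0]
  have hT := hx₀.period_pos
  obtain ⟨r, -, v, hv0, hvT, hv⟩ := hξ
  have hgn : LipschitzWith L (fun v => -g v) := hg.neg
  have htube : ∀ s ∈ Icc 0 T,
      ‖v (T - s) - x₀ (t - s)‖ ≤ ‖ξ - x₀ t‖ * Real.exp ((L + 1) * (T - 0)) := by
    refine norm_sub_le_of_approx_solution hgn (u := fun s => v (T - s)) (y := fun s => x₀ (t - s))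
      (f := fun s => -ψ (v (T - s))) (m := 0) (hasDerivWithinAt_reverse hv) (fun s _ => ?_)
      (fun s _ hs => ?_) (norm_pos_iff.2 h0) (norm_pos_iff.2 h0) (by simp [hvT])
      (by rwa [sub_zero])
    · rw [hgψ _ (by linarith [hR (t - s)])]
      have h2 := (hx₀.solution (t - s)).scomp s ((hasDerivAt_id s).const_sub t)
      rw [neg_smul, one_smul] at h2
      exact h2.hasDerivWithinAt
    · have h3 : ‖v (T - s)‖ ≤ R + 1 := by
        calc _ = ‖x₀ (t - s) + (v (T - s) - x₀ (t - s))‖ := by congr 1; abel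
          _ ≤ _ := (norm_add_le _ _).trans (add_le_add (hR _) hs)
      rw [hgψ _ h3, sub_self, norm_zero]
  rw [sub_zero] at htube
  have hm : MapsTo (fun s => s - (t - T)) (Icc (t - T) t) (Icc 0 T) := by
    intro s hs
    exact ⟨by linarith [hs.1], by linarith [hs.2]⟩
  have key := abs_inner_increment_sub_integral_le hx₀.solution hR hz₀.solution hη hlin
    (show t - T ≤ t by linarith) hZ (u := fun s => v (s - (t - T))) (e := fun _ => 0)
    (q := fun _ => 0) (μ := 0) (W := ‖ξ - x₀ t‖ * Real.exp ((L + 1) * T)) continuous_const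
    (fun s hs => ?_) (fun s hs => ?_) hδ (by simp)
  · have hz : z₀ (t - T) = z₀ t := by
      have := hz₀.multiplier (t - T)
      rw [sub_add_cancel, one_smul] at this
      exact this.symm
    simpa [hv0, hvT, hx₀.periodic.sub_eq, hz, inner_h_sub] using key
  · rw [add_zero]
    have h4 := (hv _ (hm hs)).scomp s
      ((hasDerivAt_id s).sub_const (t - T)).hasDerivWithinAt hm
    rw [one_smul] at h4
    exact h4
  · have h5 := htube (T - (s - (t - T))) ⟨by linarith [hs.2], by linarith [hs.1]⟩
    rwa [sub_sub_cancel, show t - (T - (s - (t - T))) = s by ring] at h5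

theorem abs_inner_sub_le_of_periodic {g : Plane → Plane} {L : NNReal} (hg : LipschitzWith L g)
    (hx₀ : IsLimitCycle ψ x₀ T) {R M : ℝ} (hR : ∀ t, ‖x₀ t‖ ≤ R)
    (hgψ : ∀ v, ‖v‖ ≤ R + 1 → g v = ψ v)
    (hφ : ContinuousOn (fun p : ℝ × Plane × ℝ => φ p.1 p.2.1 p.2.2) (univ ×ˢ univ ×ˢ Icc 0 1))
    (hM0 : 0 ≤ M) (hM : ∀ t v, ‖v‖ ≤ R + 1 → ∀ ε ∈ Icc (0 : ℝ) 1, ‖φ t v ε‖ ≤ M) {ρ : ℝ}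
    {z₁ : ℝ → Plane} (hz₁ : IsEigenfunction (adjointLinearization ψ x₀) T ρ z₁) {Z η δ : ℝ}
    (hη : 0 ≤ η)
    (hlin : ∀ p q, ‖p‖ ≤ R → ‖q - p‖ ≤ δ →
      ‖ψ q - ψ p - fderiv ℝ ψ p (q - p)‖ ≤ η * ‖q - p‖) {t θ θ₀ : ℝ}
    (hmod : ∀ s ∈ Icc (t - T) t, ∀ v p, ‖p‖ ≤ R → ‖v - p‖ ≤ δ →
      ∀ ε ∈ Icc (0 : ℝ) 1, ε ≤ δ → ‖φ (s - θ) v ε - φ (s - θ₀) p 0‖ ≤ η)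
    (hZ : ∀ s ∈ Icc (t - T) t, ‖z₁ s‖ ≤ Z) {ε : ℝ} (hε : ε ∈ Ioo (0 : ℝ) 1) (hεδ : ε ≤ δ)
    {x : ℝ → Plane} (hx : IsPerturbedSolution ψ φ ε x) (hxT : Function.Periodic x T)
    (h1 : (‖x (t - θ) - x₀ t‖ + ε * (M + 1)) * Real.exp ((L + 1) * T) ≤ 1)
    (hδ : (‖x (t - θ) - x₀ t‖ + ε * (M + 1)) * Real.exp ((L + 1) * T) ≤ δ) :
    |(ρ - 1) * inner ℝ (z₁ (t - T)) (x (t - θ) - x₀ t) - ε * f₁ φ x₀ z₁ T θ₀ t| ≤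
      Z * (η * ((‖x (t - θ) - x₀ t‖ + ε * (M + 1)) * Real.exp ((L + 1) * T)) + ε * η) * T := by
  have hT := hx₀.period_pos
  have hε' := Ioo_subset_Icc_self hε
  have hxa : x (t - T - θ) = x (t - θ) := by
    rw [show t - T - θ = t - θ - T by ring, hxT.sub_eq]
  have hεM : 0 < ε * (M + 1) := mul_pos hε.1 (by linarith)
  -- `M + 1` in place of `M` makes `C` strictly exceed the defect `ε * M`, even when the initial
  -- distance is zero.
  have htube := norm_perturbed_sub_le hg hx₀.solution hR hgψ hM hε' hx (θ := θ)
    (a := t - T) (b := t) (C := ‖x (t - θ) - x₀ t‖ + ε * (M + 1)) (by positivity)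
    (by linarith [norm_nonneg (x (t - θ) - x₀ t), hε.1])
    (by rw [hxa, hx₀.periodic.sub_eq]; linarith) (by rwa [sub_sub_cancel])
  rw [sub_sub_cancel] at htube
  have hq : Continuous fun s => φ (s - θ₀) (x₀ s) 0 := by
    have hc := hx₀.continuous
    exact hφ.comp_continuous (f := fun s : ℝ => (s - θ₀, x₀ s, (0 : ℝ))) (by fun_prop) (by simp)
  have key := abs_inner_increment_sub_integral_le hx₀.solution hR hz₁.solution hη hlin
    (show t - T ≤ t by linarith) hZ (u := fun s => x (s - θ))
    (e := fun s => ε • φ (s - θ) (x (s - θ)) ε) (q := fun s => ε • φ (s - θ₀) (x₀ s) 0)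
    (μ := ε * η) (hq.const_smul ε)
    (fun s _ => ((hx (s - θ)).comp_sub_const s θ).hasDerivWithinAt) htube hδ (fun s hs => ?_)
  · have hz : z₁ t = ρ • z₁ (t - T) := by
      have := hz₁.multiplier (t - T)
      rwa [sub_add_cancel] at this
    simp only [real_inner_smul_right, intervalIntegral.integral_const_mul, hxa,
      hx₀.periodic.sub_eq, sub_sub_cancel] at key
    rw [hz, real_inner_smul_left] at key
    rw [f₁, sub_one_mul]
    exact key
  · rw [← smul_sub, norm_smul, Real.norm_of_nonneg hε.1.le]
    exact mul_le_mul_of_nonneg_left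
      (hmod s hs _ _ (hR s) ((htube s hs).trans hδ) ε hε' hεδ) hε.1.le

/-- The shifts in the hypothesis depend on `δ`. Taking for each `(ε, t)` an admissible shift whose
distance to `θ₀` is within `ε` of the infimum gives one family that serves every `δ`, with no
attainment of the infimum needed. -/
theorem exists_isShiftFamily {z₀ : ℝ → Plane} {θ₀ r₀ : ℝ} {x : ℝ → ℝ → Plane}
    (hs : ∀ δ > 0, ∀ᶠ ε in 𝓝[>] (0 : ℝ), ∀ t ∈ Icc 0 T,
      ∃ θ, |θ - θ₀| ≤ δ ∧ x ε (t - θ) ∈ arc ψ x₀ z₀ T t r₀) :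
    ∃ ε₀ > 0, ∃ θ, IsShiftFamily ψ x₀ z₀ T θ₀ r₀ ε₀ x θ := by
  obtain ⟨ε₀, hε₀, hsub⟩ := mem_nhdsGT_iff_exists_Ioo_subset.1 (hs 1 one_pos)
  have hex : ∀ ε t, ∃ θ, ε ∈ Ioo 0 ε₀ → t ∈ Icc 0 T → x ε (t - θ) ∈ arc ψ x₀ z₀ T t r₀ ∧
      ∀ θ', x ε (t - θ') ∈ arc ψ x₀ z₀ T t r₀ → |θ - θ₀| < |θ' - θ₀| + ε := by
    intro ε t
    by_cases h : ε ∈ Ioo 0 ε₀ ∧ t ∈ Icc 0 T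
    · obtain ⟨θ₁, -, hθ₁⟩ := hsub h.1 t h.2
      have hne : {θ | x ε (t - θ) ∈ arc ψ x₀ z₀ T t r₀}.Nonempty := ⟨θ₁, hθ₁⟩
      obtain ⟨θ, hθ, hlt⟩ := (Metric.infDist_lt_iff hne).1 (lt_add_of_pos_right
        (Metric.infDist θ₀ {θ | x ε (t - θ) ∈ arc ψ x₀ z₀ T t r₀}) h.1.1)
      refine ⟨θ, fun _ _ => ⟨hθ, fun θ' hθ' => ?_⟩⟩
      rw [dist_comm, Real.dist_eq] at hlt
      have := Metric.infDist_le_dist_of_mem (x := θ₀)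
        (s := {θ | x ε (t - θ) ∈ arc ψ x₀ z₀ T t r₀}) hθ'
      rw [dist_comm, Real.dist_eq] at this
      linarith
    · exact ⟨0, fun h1 h2 => absurd ⟨h1, h2⟩ h⟩
  choose θ hθ using hex
  refine ⟨ε₀, hε₀, θ, ?_, fun ε hε t ht => (hθ ε t hε ht).1⟩
  rw [Metric.tendstoUniformlyOn_iff]
  intro δ hδ
  filter_upwards [hs (δ / 2) (by positivity), Ioo_mem_nhdsGT hε₀,
    Ioo_mem_nhdsGT (show (0 : ℝ) < δ / 2 by positivity)] with ε h1 h2 h3 t ht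
  obtain ⟨θ', hθ', hmem⟩ := h1 t ht
  have := (hθ ε t h2 ht).2 θ' hmem
  rw [dist_comm, Real.dist_eq]
  linarith [h3.2]

end

end LimitCycle

/-! ### The main estimate -/

theorem corollary1
    (ψ : LimitCycle.Plane → LimitCycle.Plane) (hψ : ContDiff ℝ 1 ψ)
    (T : ℝ) (x₀ : ℝ → LimitCycle.Plane) (hx₀ : LimitCycle.IsLimitCycle ψ x₀ T)
    (hmult : LimitCycle.HasSimpleMultiplierOne (LimitCycle.linearization ψ x₀) T)
    (z₀ : ℝ → LimitCycle.Plane)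
    (hz₀ : LimitCycle.IsEigenfunction (LimitCycle.adjointLinearization ψ x₀) T 1 z₀)
    (ρ : ℝ) (hρ : ρ ≠ 1) (z₁ : ℝ → LimitCycle.Plane)
    (hz₁ : LimitCycle.IsEigenfunction (LimitCycle.adjointLinearization ψ x₀) T ρ z₁)
    (φ : ℝ → LimitCycle.Plane → ℝ → LimitCycle.Plane)
    (hφ : ContinuousOn (fun p : ℝ × LimitCycle.Plane × ℝ => φ p.1 p.2.1 p.2.2)
      (univ ×ˢ univ ×ˢ Icc 0 1))
    (hφT : ∀ t v, ∀ ε ∈ Icc (0 : ℝ) 1, φ (t + T) v ε = φ t v ε)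
    (θ₀ : ℝ) (hθ₀ : θ₀ ∈ Icc 0 T)
    (x : ℝ → ℝ → LimitCycle.Plane)
    (hx : ∀ᶠ ε in 𝓝[>] (0 : ℝ),
      LimitCycle.IsPerturbedSolution ψ φ ε (x ε) ∧ Function.Periodic (x ε) T)
    (hconv : ∀ t ∈ Icc 0 T, Tendsto (fun ε => x ε (t - θ₀)) (𝓝[>] 0) (𝓝 (x₀ t))) :
    ∃ r₀ ∈ Ioc (0 : ℝ) 1, ∃ ε₀ > (0 : ℝ),
      -- `I(t, r)` is defined for all `t ∈ [0, T]` and `r ∈ [-r₀, r₀]`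
      (∀ t ∈ Icc 0 T, ∀ r ∈ Icc (-r₀) r₀,
        ∃ η, LimitCycle.IsFlowValue ψ T (LimitCycle.h x₀ z₀ t r) η) ∧
      -- shifts as required exist
      (∃ θ : ℝ → ℝ → ℝ, LimitCycle.IsShiftFamily ψ x₀ z₀ T θ₀ r₀ ε₀ x θ) ∧
      -- for all such shifts the distance is `o(ε)`, uniformly over the zeros of `f₁(θ₀, ·)`
      (∀ θ : ℝ → ℝ → ℝ, LimitCycle.IsShiftFamily ψ x₀ z₀ T θ₀ r₀ ε₀ x θ →
        ∀ δ > (0 : ℝ), ∀ᶠ ε in 𝓝[>] (0 : ℝ), ∀ t ∈ Icc 0 T,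
          LimitCycle.f₁ φ x₀ z₁ T θ₀ t = 0 →
            ‖x ε (t - θ ε t) - x₀ t‖ ≤ δ * ε) := by
  have hT := hx₀.period_pos
  obtain ⟨R, hR⟩ := hx₀.exists_norm_le
  obtain ⟨g, L, M, hg, hgM, hgψ⟩ := LimitCycle.exists_bounded_lipschitz_eqOn hψ (R + 1)
  obtain ⟨N, hN0, hN⟩ := LimitCycle.exists_norm_perturbation_le hφ hT hφT (R + 1)
  obtain ⟨K, hK⟩ := hx₀.exists_norm_adjoint_le hψ
  have hz₀ne := hz₀.ne_zero hK
  have hz₀c : ∀ t, inner ℝ (z₀ t) (ψ (x₀ t)) = (inner ℝ (z₀ 0) (ψ (x₀ 0)) : ℝ) := fun t =>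
    LimitCycle.inner_velocity_const hψ hx₀.solution hz₀.solution t 0
  have hc : (inner ℝ (z₀ 0) (ψ (x₀ 0)) : ℝ) ≠ 0 := fun h0 =>
    hx₀.velocity_ne_zero hψ 0 (LimitCycle.eq_zero_of_inner_eigenfunctions hK hz₀ hρ hz₁ h0
      (LimitCycle.inner_velocity_eq_zero hψ hx₀ hρ hz₁ 0))
  obtain ⟨Z₀, hZ₀⟩ := (isCompact_Icc (a := -T) (b := T)).exists_bound_of_continuousOn
    hz₀.continuous.continuousOn
  obtain ⟨Z₁, hZ₁⟩ := (isCompact_Icc (a := -T) (b := T)).exists_bound_of_continuousOn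
    hz₁.continuous.continuousOn
  have hclose : ∀ κ > 0, ∀ᶠ ε in 𝓝[>] (0 : ℝ), ∀ s, ‖x ε (s - θ₀) - x₀ s‖ ≤ κ := fun κ hκ =>
    LimitCycle.eventually_norm_perturbed_sub_le hg hx₀ hR hgψ hN hx
      (hconv 0 (left_mem_Icc.2 hT.le)) hκ
  have hLT : 0 ≤ L * T := mul_nonneg L.coe_nonneg hT.le
  -- By Grönwall, this radius keeps truncated trajectories from `h(t, r)` within distance `1` of the
  -- cycle on `[0, T]`, where `g = ψ`.
  have hr₀ : Real.exp (-(L * T)) ∈ Ioc (0 : ℝ) 1 :=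
    ⟨Real.exp_pos _, Real.exp_le_one_iff.2 (by linarith)⟩
  obtain ⟨ε₀, hε₀, hfam⟩ := LimitCycle.exists_isShiftFamily (ψ := ψ) (x₀ := x₀) (z₀ := z₀) (T := T)
    (θ₀ := θ₀) (r₀ := Real.exp (-(L * T))) (x := x) (fun δ hδ => by
      obtain ⟨κ, hκ, h⟩ := LimitCycle.exists_shift_mem_arc hg hgM hx₀ hR hgψ hz₀ne
        (fun t ht => hZ₀ t ⟨by linarith [ht.1], ht.2⟩) hc hz₀c hr₀.1 hr₀.2 hδ
      filter_upwards [hclose κ hκ, hx] with ε h1 h2 t ht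
      have hcont : Continuous (x ε) := continuous_iff_continuousAt.2 fun s => (h2.1 s).continuousAt
      obtain ⟨σ, hσ, hmem⟩ := h (fun s => x ε (s - θ₀)) (by fun_prop) h1 t ht
      refine ⟨θ₀ - σ, by simpa using hσ, ?_⟩
      rwa [show t - (θ₀ - σ) = t + σ - θ₀ by ring])
  refine ⟨_, hr₀, ε₀, hε₀, fun t _ r hr => ?_, hfam, fun θ hθ δ hδ => ?_⟩
  · refine LimitCycle.isFlowValue_of_near hg hgM hT hx₀.solution hR hgψ (t := t) ?_
    rw [LimitCycle.norm_h_sub (hz₀ne t)]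
    calc _ ≤ Real.exp (L * T) * Real.exp (-(L * T)) := by gcongr; exact abs_le.2 hr
      _ ≤ 1 := by rw [← Real.exp_add]; simp
  obtain ⟨m, hm, hlow⟩ := LimitCycle.exists_lower_bound_inner_eigenfunctions hK hz₀ hρ hz₁ (-T) T
  have hk : 0 < |ρ - 1| := abs_pos.2 (sub_ne_zero.2 hρ)
  set k := |ρ - 1| with hkdef
  set D := Real.exp ((L + 1) * T) with hD
  have hD0 : 0 < D := Real.exp_pos _
  -- The first condition lets half of `m * k * ‖w‖` absorb the errors proportional to `‖w‖`; the
  -- second bounds the errors proportional to `ε` by `m * k / 2 * δ * ε`.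
  obtain ⟨η, ⟨hη1, hη2⟩, hη0⟩ :=
    ((LimitCycle.eventually_mul_le (T * D * (k * Z₀ + Z₁)) (by positivity : 0 < m * k / 2)).and
      (LimitCycle.eventually_mul_le (Z₁ * T * (D * (N + 1) + 1))
        (by positivity : 0 < m * k / 2 * δ))).and self_mem_nhdsWithin |>.exists
  replace hη0 : 0 < η := hη0
  obtain ⟨δ₁, hδ₁, hlin⟩ := LimitCycle.exists_uniform_linearization_bound hψ R hη0
  obtain ⟨δ₂, hδ₂, hmod⟩ :=
    LimitCycle.exists_uniform_perturbation_modulus hφ R (-T) T θ₀ hη0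
  set δ₃ := min 1 (min δ₁ δ₂) with hδ₃def
  have hδ₃ : 0 < δ₃ := by positivity
  have hδ₃1 : δ₃ ≤ 1 := min_le_left _ _
  have hδ₃δ₁ : δ₃ ≤ δ₁ := (min_le_right _ _).trans (min_le_left _ _)
  have hδ₃δ₂ : δ₃ ≤ δ₂ := (min_le_right _ _).trans (min_le_right _ _)
  obtain ⟨κ, ⟨hκ1, hκ2⟩, hκ0⟩ :=
    ((LimitCycle.eventually_mul_le ((1 + M) * D) (by positivity : 0 < δ₃ / 2)).and
      (LimitCycle.eventually_mul_le 1 hδ₃)).and self_mem_nhdsWithin |>.exists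
  replace hκ0 : 0 < κ := hκ0
  rw [one_mul] at hκ2
  have hθκ := Metric.tendstoUniformlyOn_iff.1 hθ.tendsto κ hκ0
  filter_upwards [hclose κ hκ0, hx, hθκ, Ioo_mem_nhdsGT hε₀, Ioo_mem_nhdsGT one_pos,
    LimitCycle.eventually_mul_le ((N + 1) * D) (by positivity : 0 < δ₃ / 2),
    LimitCycle.eventually_mul_le 1 hδ₃] with ε hu hxε hθε hεε₀ hε1 hε2 hε3 t ht hf
  rw [one_mul] at hε3
  have hθt : |θ ε t - θ₀| < κ := by
    have := hθε t ht
    rwa [dist_comm, Real.dist_eq] at this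
  set ξ := x ε (t - θ ε t) with hξ
  have hW : ‖ξ - x₀ t‖ ≤ (1 + M) * κ := by
    have h1 := hu (t - θ ε t + θ₀)
    rw [add_sub_cancel_right] at h1
    have h2 : ‖x₀ (t - θ ε t + θ₀) - x₀ t‖ ≤ M * ‖t - θ ε t + θ₀ - t‖ :=
      convex_univ.norm_image_sub_le_of_norm_hasDerivWithin_le (f := x₀)
        (fun s _ => (hx₀.solution s).hasDerivWithinAt)
        (fun s _ => by rw [← hgψ _ (by linarith [hR s])]; exact hgM _)
        (mem_univ _) (mem_univ _)
    rw [show t - θ ε t + θ₀ - t = -(θ ε t - θ₀) by ring, norm_neg, Real.norm_eq_abs] at h2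
    calc ‖ξ - x₀ t‖ = ‖(ξ - x₀ (t - θ ε t + θ₀)) + (x₀ (t - θ ε t + θ₀) - x₀ t)‖ := by
          congr 1; abel
      _ ≤ κ + M * |θ ε t - θ₀| := (norm_add_le _ _).trans (add_le_add h1 h2)
      _ ≤ κ + M * κ := by gcongr
      _ = _ := by ring
  have hWD : ‖ξ - x₀ t‖ * D ≤ δ₃ / 2 := by
    calc _ ≤ (1 + M) * κ * D := by gcongr
      _ ≤ _ := by linarith
  have hWεD : (‖ξ - x₀ t‖ + ε * (N + 1)) * D ≤ δ₃ := by linarith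
  have hsub : Icc (t - T) t ⊆ Icc (-T) T :=
    Icc_subset_Icc (by linarith [ht.1]) ht.2
  have hlin₃ : ∀ p q, ‖p‖ ≤ R → ‖q - p‖ ≤ δ₃ →
      ‖ψ q - ψ p - fderiv ℝ ψ p (q - p)‖ ≤ η * ‖q - p‖ :=
    fun p q hp hq => hlin p q hp (hq.trans hδ₃δ₁)
  have e₀ := LimitCycle.abs_inner_sub_le_of_mem_arc hg hx₀ hR hgψ hz₀ hη0.le hlin₃
    (fun s hs => hZ₀ s (hsub hs)) (hθ.mem_arc ε hεε₀ t ht) (by linarith) (by linarith)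
  have e₁ := LimitCycle.abs_inner_sub_le_of_periodic hg hx₀ hR hgψ hφ hN0 hN hz₁ hη0.le hlin₃
    (θ := θ ε t) (θ₀ := θ₀)
    (fun s hs v p hp hv ε' hε' hεδ' => hmod s (hsub hs) _ (hθt.le.trans (hκ2.trans hδ₃δ₂)) v p hp
      (hv.trans hδ₃δ₂) ε' hε' (hεδ'.trans hδ₃δ₂))
    (fun s hs => hZ₁ s (hsub hs)) hε1 hε3 hxε.1 hxε.2 (hWεD.trans hδ₃1) hWεD
  rw [hf, mul_zero, sub_zero, abs_mul, ← hkdef] at e₁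
  -- The lower bound is used at `t - T`, where `e₁` evaluates `z₁`; periodicity of `z₀` moves its
  -- pairing to time `t`, where `e₀` applies.
  have hlow' := hlow (t - T) (hsub ⟨le_rfl, by linarith⟩) (ξ - x₀ t)
  have hz : z₀ (t - T) = z₀ t := by
    have := hz₀.multiplier (t - T)
    rw [sub_add_cancel, one_smul] at this
    exact this.symm
  rw [hz] at hlow'
  have h1 := mul_le_mul_of_nonneg_left hlow' hk.le
  have h2 := mul_le_mul_of_nonneg_left e₀ hk.le
  have h3 := mul_le_mul_of_nonneg_right hη1 (norm_nonneg (ξ - x₀ t))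
  have h4 := mul_le_mul_of_nonneg_right hη2 hε1.1.le
  have h5 : m * k / 2 * ‖ξ - x₀ t‖ ≤ m * k / 2 * (δ * ε) := by
    rw [← hξ, ← hD] at e₁
    rw [← hD] at h2
    linarith
  exact le_of_mul_le_mul_left h5 (by positivity)
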